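/- Let $k$ be an algebraically closed field of characteristic $p>0$, with Frobenius automorphism $\sigma\colon x\mapsto x^p$. A \emph{Hasse--Witt triple} (HW-triple) over $k$ is a triple $(Q,\Phi,\Psi)$ consisting of a finite dimensional $k$-vector space $Q$, a $\sigma$-linear map $\Phi\colon Q\to Q$, and a $\sigma$-linear bijection $\Psi\colon \operatorname{Ker}(\Phi)\to \operatorname{Im}(\Phi)^\perp$, where $\operatorname{Im}(\Phi)^\perp=\{\lambda\in Q^\vee \mid \lambda(q)=0 \text{ for all } q\in\operatorname{Im}(\Phi)\}$. Let $(Q_1,\Phi_1,\Psi_1)$ and $(Q_2,\Phi_2,\Psi_2)$ be HW-triples over $k$. They are called \emph{equivalent} if there exist a $k$-linear bijection $f\colon Q_1\to Q_2$ and constants $c,d\in k^*$ such that $$\Phi_2\circ f = c\cdot (f\circ\Phi_1)\qquad\text{and}\qquad \Psi_2\circ f|_{\operatorname{Ker}(\Phi_1)} = d\cdot \bigl((f^{\vee})^{-1}\circ\Psi_1\bigr),$$ where $f^\vee\colon Q_2^\vee\to Q_1^\vee$ is the dual map of $f$. They are called \emph{isomorphic} if there exists such an $f$ with $c=d=1$.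 If two HW-triples over $k$ are equivalent, then they are isomorphic. -/

import Mathlib

/-- Over a perfect ring of characteristic `p` the Frobenius `σ = frobenius k p` is surjective, so
that the image of a `σ`-linear map is a submodule. -/
instance HWTriple.frobenius_ringHomSurjective (p : ℕ) (k : Type*) [Field k] [ExpChar k p]
    [PerfectRing k p] : RingHomSurjective (frobenius k p) :=
  ⟨(bijective_frobenius k p).surjective⟩

/-- A Hasse–Witt triple `(Q, Φ, Ψ)` over a perfect field `k` of characteristic `p > 0`, on a finite
dimensional `k`-vector space `Q`. With `σ` the Frobenius of `k`, `Φ : Q → Q` is `σ`-linear and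
`Ψ : Ker Φ → (Im Φ)^⊥ ⊆ Q^∨` is `σ`-linear and bijective. -/
structure HWTriple (p : ℕ) [Fact p.Prime] (k : Type*) [Field k] [CharP k p] [PerfectRing k p]
    (Q : Type*) [AddCommGroup Q] [Module k Q] [FiniteDimensional k Q] where
  /-- The `σ`-linear endomorphism. -/
  Φ : Q →ₛₗ[frobenius k p] Q
  /-- The `σ`-linear map from the kernel of `Φ` to the annihilator of the image of `Φ`. -/
  Ψ : LinearMap.ker Φ →ₛₗ[frobenius k p] (LinearMap.range Φ).dualAnnihilator
  bijective_Ψ : Function.Bijective Ψ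

namespace HWTriple

variable {p : ℕ} [Fact p.Prime] {k : Type*} [Field k] [CharP k p] [PerfectRing k p]
  {Q₁ Q₂ : Type*} [AddCommGroup Q₁] [Module k Q₁] [FiniteDimensional k Q₁]
  [AddCommGroup Q₂] [Module k Q₂] [FiniteDimensional k Q₂]

/-- If `Φ₂ ∘ f = c • (f ∘ Φ₁)` then `f` maps `Ker Φ₁` to `Ker Φ₂`. -/
theorem map_mem_ker {T₁ : HWTriple p k Q₁} {T₂ : HWTriple p k Q₂} {f : Q₁ ≃ₗ[k] Q₂} {c : k}
    (h : ∀ x, T₂.Φ (f x) = c • f (T₁.Φ x)) (x : LinearMap.ker T₁.Φ) :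
    f x ∈ LinearMap.ker T₂.Φ := by
  have hx : T₁.Φ x = 0 := x.2
  rw [LinearMap.mem_ker, h, hx, map_zero, smul_zero]

/-- `f` satisfies `Φ₂ ∘ f = c • (f ∘ Φ₁)` and `Ψ₂ ∘ f = d • (f^{∨,-1} ∘ Ψ₁)`; the second identity is
one between maps `Ker Φ₁ → Q₂^∨`. -/
def Intertwines (T₁ : HWTriple p k Q₁) (T₂ : HWTriple p k Q₂) (c d : k) (f : Q₁ ≃ₗ[k] Q₂) : Prop :=
  ∃ h : ∀ x, T₂.Φ (f x) = c • f (T₁.Φ x),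
    ∀ x : LinearMap.ker T₁.Φ,
      (T₂.Ψ ⟨f x, map_mem_ker h x⟩ : Module.Dual k Q₂) =
        d • f.dualMap.symm (T₁.Ψ x : Module.Dual k Q₁)

/-- Two HW-triples are equivalent if some linear bijection respects `Φ` and `Ψ` up to nonzero
scalars. -/
def Equivalent (T₁ : HWTriple p k Q₁) (T₂ : HWTriple p k Q₂) : Prop :=
  ∃ (f : Q₁ ≃ₗ[k] Q₂) (c d : k), c ≠ 0 ∧ d ≠ 0 ∧ T₁.Intertwines T₂ c d f

/-- Two HW-triples are isomorphic if some linear bijection satisfies `Φ₂ ∘ f = f ∘ Φ₁` and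
`Ψ₂ ∘ f = f^{∨,-1} ∘ Ψ₁`. -/
def Isomorphic (T₁ : HWTriple p k Q₁) (T₂ : HWTriple p k Q₂) : Prop :=
  ∃ f : Q₁ ≃ₗ[k] Q₂, T₁.Intertwines T₂ 1 1 f

end HWTriple

/-!
It suffices to find, for given nonzero `c` and `d`, an automorphism `g` of `Q` which intertwines
`(Q, Φ, Ψ)` with itself up to the scalars `c` and `d`. Refining the chain `0 ⊆ Q` by images under
`Φ` and orthogonal spaces under `Ψ` leads to a stable chain, on whose graded pieces `Φ` and `Ψ`
induce a partial permutation. If `g` acts on the graded pieces by scalars, the intertwining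
relations on these pieces become a system of equations `a (τ x) = t x * a (s x) ^ (± p)` with `τ`
injective. Its exponent matrix is the identity modulo `p`, so it has nonzero determinant and the
system is solvable over an algebraically closed field.

An endomorphism `h₀` with these weights is corrected by iteration: the relations
`Φ ∘ hₙ₊₁ = c • hₙ ∘ Φ` and `Ψ ∘ hₙ₊₁ = d • (hₙ^∨)⁻¹ ∘ Ψ` can be solved for `hₙ₊₁` without leaving
the given weights. If `hₙ₊₁ - hₙ` is strictly triangular for the refinement of a chain, then
`hₙ₊₂ - hₙ₊₁` is strictly triangular for the chain itself. Running down the refinements to `0 ⊆ Q`,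
the sequence becomes constant, and its limit is `g`.
-/

section Chain

theorem finite_of_isChain {α : Type*} [PartialOrder α] [WellFoundedLT α] [WellFoundedGT α]
    {D : Set α} (hD : IsChain (· ≤ ·) D) : D.Finite := by
  classical
  let _ : LinearOrder D := hD.linearOrder
  exact Finite.of_wellFoundedLT_wellFoundedGT D

theorem supClosed_of_isChain {α : Type*} [SemilatticeSup α] {D : Set α}
    (hD : IsChain (· ≤ ·) D) : SupClosed D := by
  intro a ha b hb
  rcases hD.total ha hb with h | h
  · rwa [sup_of_le_right h]
  · rwa [sup_of_le_left h]

theorem exists_eq_succ_of_monotone_isChain {α : Type*} [PartialOrder α] [WellFoundedLT α]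
    [WellFoundedGT α] {E : ℕ → Set α} (hmono : Monotone E)
    (hE : ∀ n, IsChain (· ≤ ·) (E n)) : ∃ n, E (n + 1) = E n := by
  have hdir : DirectedOn (· ⊆ ·) (Set.range E) := hmono.directed_le.directedOn_range
  have hchain : IsChain (· ≤ ·) (⋃₀ Set.range E) := by
    rintro a ⟨_, ⟨m, rfl⟩, ha⟩ b ⟨_, ⟨n, rfl⟩, hb⟩ hab
    exact hE (max m n) (hmono (le_max_left m n) ha) (hmono (le_max_right m n) hb) hab
  obtain ⟨_, ⟨n, rfl⟩, hn⟩ := DirectedOn.exists_mem_subset_of_finite_of_subset_sUnion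
    (Set.range_nonempty E) hdir (finite_of_isChain hchain) subset_rfl
  have hsucc : E (n + 1) ⊆ E n := (Set.subset_sUnion_of_mem (Set.mem_range_self _)).trans hn
  exact ⟨n, hsucc.antisymm (hmono n.le_succ)⟩

variable {α : Type*} [CompleteLattice α] {D : Set α} {a b : α}

/-- The predecessor of `b` in a chain `D`, encoded as the supremum of the members of `D` strictly
below `b`; it is `⊥` if there are none. -/
def chainPred (D : Set α) (b : α) : α := sSup {a ∈ D | a < b}

theorem chainPred_le : chainPred D b ≤ b := sSup_le fun _ ha => ha.2.le

theorem le_chainPred (ha : a ∈ D) (hab : a < b) : a ≤ chainPred D b := le_sSup ⟨ha, hab⟩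

theorem le_chainPred_or_le (hD : IsChain (· ≤ ·) D) (ha : a ∈ D) (hb : b ∈ D) :
    a ≤ chainPred D b ∨ b ≤ a := by
  rcases hD.total hb ha with h | h
  · exact Or.inr h
  · exact h.lt_or_eq.imp (le_chainPred ha) Eq.ge

theorem chainPred_bot_top : chainPred {⊥, ⊤} (⊤ : α) = ⊥ := by
  refine eq_bot_iff.2 (sSup_le ?_)
  rintro _ ⟨rfl | rfl, h⟩
  · exact le_rfl
  · exact absurd h (lt_irrefl _)

variable [WellFoundedLT α] [WellFoundedGT α]

theorem chainPred_mem (hD : IsChain (· ≤ ·) D) (hbot : ⊥ ∈ D) (b : α) : chainPred D b ∈ D :=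
  (supClosed_of_isChain hD).sSup_mem ((finite_of_isChain hD).subset (Set.sep_subset _ _)) hbot
    (Set.sep_subset _ _)

theorem chainPred_lt (hD : IsChain (· ≤ ·) D) (hbot : ⊥ ∈ D) (hb : b ≠ ⊥) :
    chainPred D b < b := by
  have hS : IsChain (· ≤ ·) {a ∈ D | a < b} := hD.mono (Set.sep_subset _ _)
  exact ((supClosed_of_isChain hS).sSup_mem (finite_of_isChain hS) ⟨hbot, bot_lt_iff_ne_bot.2 hb⟩
    subset_rfl).2

/-- A complement `w` of `a` is adapted to a set `D` if every member of `D` is the supremum of its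
parts below `a` and below `w`. -/
structure IsAdaptedCompl (D : Set α) (a w : α) : Prop where
  isCompl : IsCompl a w
  le_sup : ∀ b ∈ D, b ≤ (b ⊓ a) ⊔ (b ⊓ w)

theorem exists_isAdaptedCompl [IsModularLattice α] [ComplementedLattice α]
    (hD : IsChain (· ≤ ·) D) (hbot : ⊥ ∈ D) (htop : ⊤ ∈ D) (a : α) :
    ∃ w, IsAdaptedCompl D a w := by
  have below : ∀ b ∈ D, ∃ w ≤ b, Disjoint a w ∧ ∀ c ∈ D, c ≤ b → c ≤ (c ⊓ a) ⊔ (c ⊓ w) := by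
    intro b
    induction b using WellFoundedLT.induction with
    | ind b ih =>
    intro hb
    by_cases hb0 : b = ⊥
    · subst hb0
      exact ⟨⊥, le_rfl, disjoint_bot_right, fun c _ hc => hc.trans bot_le⟩
    obtain ⟨w, hwb, haw, hw⟩ :=
      ih _ (chainPred_lt hD hbot hb0) (chainPred_mem hD hbot b)
    obtain ⟨w', hww', hw'⟩ := (haw.mono_left (inf_le_right : b ⊓ a ≤ a)).symm.exists_isCompl
    refine ⟨b ⊓ w', inf_le_left, ?_, fun c hc hcb => ?_⟩
    · rw [disjoint_iff, ← inf_assoc, inf_comm a b]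
      exact hw'.symm.inf_eq_bot
    · rcases le_chainPred_or_le hD hc hb with h | h
      · exact (hw c hc h).trans
          (sup_le_sup_left (inf_le_inf_left c (le_inf (hwb.trans chainPred_le) hww')) _)
      · obtain rfl := hcb.antisymm h
        calc c = (c ⊓ a ⊔ w') ⊓ c := by rw [hw'.symm.sup_eq_top, top_inf_eq]
          _ = c ⊓ a ⊔ w' ⊓ c := sup_inf_assoc_of_le w' inf_le_left
          _ ≤ c ⊓ a ⊔ c ⊓ (c ⊓ w') := by rw [inf_comm w' c, ← inf_assoc, inf_idem]
  obtain ⟨w, -, haw, hw⟩ := below ⊤ htop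
  exact ⟨w, ⟨haw, codisjoint_iff_le_sup.2 (by simpa only [top_inf_eq] using hw ⊤ htop le_rfl)⟩,
    fun b hb => hw b hb le_top⟩

end Chain

section Weights

variable {k V : Type*} [Field k] [AddCommGroup V] [Module k V] {D : Set (Submodule k V)}
  {a b : Submodule k V → k} {g h : V →ₗ[k] V}

/-- The endomorphism `h` respects the chain `D` and acts on the graded piece below each `L ∈ D` as
the scalar `a L`. For `a = 0` this says that `h` is strictly triangular with respect to `D`. -/
def HasWeights (D : Set (Submodule k V)) (a : Submodule k V → k) (h : V →ₗ[k] V) : Prop :=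
  ∀ L ∈ D, ∀ x ∈ L, h x - a L • x ∈ chainPred D L

theorem HasWeights.apply_mem (hh : HasWeights D a h) {L : Submodule k V} (hL : L ∈ D) {x : V}
    (hx : x ∈ L) : h x ∈ L :=
  (L.sub_mem_iff_left (L.smul_mem (a L) hx)).1 (SetLike.le_def.1 chainPred_le (hh L hL x hx))

theorem HasWeights.sub (hg : HasWeights D a g) (hh : HasWeights D b h) :
    HasWeights D (a - b) (g - h) := by
  intro L hL x hx
  have := (chainPred D L).sub_mem (hg L hL x hx) (hh L hL x hx)
  rwa [sub_sub_sub_comm, ← sub_smul] at this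

theorem eq_zero_of_hasWeights_bot_top (hh : HasWeights {⊥, ⊤} (0 : Submodule k V → k) h) :
    h = 0 := by
  ext x
  simpa [chainPred_bot_top] using hh ⊤ (by simp) x trivial

theorem exists_isProj (L : Submodule k V) : ∃ π : V →ₗ[k] V, LinearMap.IsProj L π := by
  obtain ⟨M, hM⟩ := L.exists_isCompl
  exact ⟨L.projection M hM, ⟨L.projection_apply_mem hM, fun x hx =>
    L.projection_apply_of_mem_left hM hx⟩⟩

variable [FiniteDimensional k V]

theorem HasWeights.injective (hD : IsChain (· ≤ ·) D) (hbot : ⊥ ∈ D) (htop : ⊤ ∈ D)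
    (ha : ∀ L, a L ≠ 0) (hh : HasWeights D a h) : Function.Injective h := by
  rw [← LinearMap.ker_eq_bot, eq_bot_iff]
  intro x hx
  obtain ⟨L, ⟨hL, hxL⟩, hmin⟩ := wellFounded_lt.has_min {L | L ∈ D ∧ x ∈ L}
    ⟨⊤, htop, Submodule.mem_top⟩
  by_cases hL0 : L = ⊥
  · exact hL0 ▸ hxL
  have hmem := hh L hL x hxL
  rw [LinearMap.mem_ker.1 hx, zero_sub, neg_mem_iff, Submodule.smul_mem_iff _ (ha L)] at hmem
  exact absurd (chainPred_lt hD hbot hL0) (hmin _ ⟨chainPred_mem hD hbot L, hmem⟩)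

theorem exists_mem_apply_eq_of_injective (hinj : Function.Injective h) {L : Submodule k V}
    (hL : ∀ x ∈ L, h x ∈ L) {y : V} (hy : y ∈ L) : ∃ x ∈ L, h x = y := by
  have hsurj : Function.Surjective (h.restrict hL) :=
    LinearMap.surjective_of_injective fun _ _ hxx' =>
      Subtype.ext (hinj (congrArg Subtype.val hxx'))
  obtain ⟨x, hx⟩ := hsurj ⟨y, hy⟩
  exact ⟨x, x.2, congrArg Subtype.val hx⟩

/-- The sum of `a L • (π L - π L')`, where `L'` is the predecessor of `L` and `π` a choice of
projections, works without any compatibility between the projections. -/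
theorem exists_hasWeights (hD : IsChain (· ≤ ·) D) (a : Submodule k V → k) :
    ∃ h : V →ₗ[k] V, HasWeights D a h := by
  classical
  choose π hπ using exists_isProj (k := k) (V := V)
  have hfin := finite_of_isChain hD
  refine ⟨∑ L ∈ hfin.toFinset, a L • (π L - π (chainPred D L)), fun B hB x hx => ?_⟩
  have hlower : ∀ L ∈ hfin.toFinset.erase B,
      a L • (π L x - π (chainPred D L) x) ∈ chainPred D B := by
    intro L hL
    obtain ⟨hLB, hL⟩ := Finset.mem_erase.1 hL
    rw [Set.Finite.mem_toFinset] at hL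
    refine Submodule.smul_mem _ _ ?_
    rcases hD.total hL hB with h | h
    · have hLpred := le_chainPred hL (h.lt_of_ne hLB)
      exact Submodule.sub_mem _ (hLpred ((hπ L).map_mem x))
        (hLpred (SetLike.le_def.1 chainPred_le ((hπ _).map_mem x)))
    · rw [(hπ L).map_id x (h hx), (hπ _).map_id x (le_chainPred hB (h.lt_of_ne hLB.symm) hx),
        sub_self]
      exact Submodule.zero_mem _
  have hsplit : (∑ L ∈ hfin.toFinset, a L • (π L - π (chainPred D L))) x - a B • x =
      ∑ L ∈ hfin.toFinset.erase B, a L • (π L x - π (chainPred D L) x) -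
        a B • π (chainPred D B) x := by
    simp only [LinearMap.sum_apply, LinearMap.smul_apply, LinearMap.sub_apply]
    rw [← Finset.add_sum_erase _ _ (hfin.mem_toFinset.2 hB), (hπ B).map_id x hx, smul_sub]
    abel
  rw [hsplit]
  exact Submodule.sub_mem _ (Submodule.sum_mem _ hlower)
    (Submodule.smul_mem _ _ ((hπ _).map_mem x))

end Weights

section ZPowSystem

variable {ι G : Type*} [CommGroup G] [RootableBy G ℤ]

theorem det_one_sub_smul_ne_zero [Fintype ι] [DecidableEq ι] {n : ℕ} (hn : n ≠ 1)
    (N : Matrix ι ι ℤ) : (1 - (n : ℤ) • N).det ≠ 0 := by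
  intro h0
  have : Nontrivial (ZMod n) := ZMod.nontrivial_iff.2 hn
  have hmap : (Int.castRingHom (ZMod n)).mapMatrix (1 - (n : ℤ) • N) = 1 := by
    ext i j
    rw [RingHom.mapMatrix_apply, Matrix.map_apply, Matrix.sub_apply, Matrix.smul_apply]
    simp [Matrix.one_apply, apply_ite (Int.cast : ℤ → ZMod n)]
  have hdet := (Int.castRingHom (ZMod n)).map_det (1 - (n : ℤ) • N)
  rw [hmap, h0, map_zero, Matrix.det_one] at hdet
  exact zero_ne_one hdet

theorem exists_prod_zpow_eq [Fintype ι] [DecidableEq ι] {M : Matrix ι ι ℤ} (hM : M.det ≠ 0)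
    (t : ι → G) : ∃ a : ι → G, ∀ i, ∏ j, a j ^ M i j = t i := by
  let r : ι → G := fun l => RootableBy.root (t l) M.det
  have hr : ∀ l, r l ^ M.det = t l := fun l => RootableBy.root_cancel _ hM
  refine ⟨fun j => ∏ l, r l ^ M.adjugate j l, fun i => ?_⟩
  calc ∏ j, (∏ l, r l ^ M.adjugate j l) ^ M i j
      = ∏ j, ∏ l, r l ^ (M i j * M.adjugate j l) := by
        simp only [← Finset.prod_zpow, ← zpow_mul, mul_comm]
    _ = ∏ l, r l ^ (M * M.adjugate) i l := by
        rw [Finset.prod_comm]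
        simp only [Matrix.mul_apply]
        exact Finset.prod_congr rfl fun l _ =>
          (map_sum (zpowersHom G (r l)).toAdditiveRight _ _).symm
    _ = t i := by
        rw [Matrix.mul_adjugate, Finset.prod_eq_single i]
        · simp [hr]
        · intro l _ hl
          simp [hl.symm]
        · simp

theorem exists_eq_mul_zpow [Finite ι] {n : ℕ} (hn : n ≠ 1) (s : ι → ι) (e : ι → ℤ) (t : ι → G) :
    ∃ a : ι → G, ∀ i, a i = t i * a (s i) ^ (n * e i) := by
  classical
  cases nonempty_fintype ι
  let N : Matrix ι ι ℤ := Matrix.of fun i j => if j = s i then e i else 0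
  obtain ⟨a, ha⟩ := exists_prod_zpow_eq (det_one_sub_smul_ne_zero hn N) t
  refine ⟨a, fun i => ?_⟩
  have hfactor : ∀ j, a j ^ (1 - (n : ℤ) • N) i j =
      (if i = j then a j else 1) / (if j = s i then a j ^ (n * e i) else 1) := by
    intro j
    simp only [N, Matrix.sub_apply, Matrix.smul_apply, Matrix.one_apply, Matrix.of_apply, zpow_sub]
    split_ifs <;> simp [div_eq_mul_inv]
  rw [← ha i]
  simp only [hfactor, Finset.prod_div_distrib, Finset.prod_ite_eq, Finset.prod_ite_eq',
    Finset.mem_univ, if_true, div_mul_cancel]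

theorem exists_apply_eq_mul_zpow [Finite ι] {X : Type*} {n : ℕ} (hn : n ≠ 1) {τ : X → ι}
    (hτ : Function.Injective τ) (s : X → ι) (e : X → ℤ) (t : X → G) :
    ∃ a : ι → G, ∀ x, a (τ x) = t x * a (s x) ^ (n * e x) := by
  obtain ⟨a, ha⟩ := exists_eq_mul_zpow hn (Function.extend τ s id) (Function.extend τ e 0)
    (Function.extend τ t 1)
  exact ⟨a, fun x => by simpa only [hτ.extend_apply] using ha (τ x)⟩

noncomputable instance rootableByUnitsOfIsAlgClosed {k : Type*} [Field k] [IsAlgClosed k] :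
    RootableBy kˣ ℤ :=
  let _ := rootableByOfPowLeftSurj kˣ ℕ fun {n} hn x => by
    obtain ⟨z, hz⟩ := IsAlgClosed.exists_pow_nat_eq (x : k) (Nat.pos_of_ne_zero hn)
    exact ⟨Units.mk0 z fun h => x.ne_zero (by rw [← hz, h, zero_pow hn]), Units.ext hz⟩
  Group.rootableByIntOfRootableByNat kˣ

end ZPowSystem

theorem exists_linearMap_semilinear_apply_eq {R S V U X : Type*} [Semiring R] [Semiring S]
    {σ : R →+* S} [AddCommMonoid V] [Module R V] [AddCommMonoid X] [Module R X] [AddCommMonoid U]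
    [Module S U] {f : V →ₛₗ[σ] U} (hf : Function.Injective f) (g : X →ₛₗ[σ] U)
    (hfg : ∀ x, ∃ v, f v = g x) : ∃ u : X →ₗ[R] V, ∀ x, f (u x) = g x := by
  choose u hu using hfg
  refine ⟨{ toFun := u, map_add' := fun x y => hf ?_, map_smul' := fun r x => hf ?_ }, hu⟩
  · rw [hu, map_add, map_add, hu, hu]
  · rw [hu, map_smulₛₗ, RingHom.id_apply, map_smulₛₗ, hu]

namespace HWTriple

variable {p : ℕ} [Fact p.Prime] {k : Type*} [Field k] [CharP k p]

section Refinement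

variable [PerfectRing k p] {Q : Type*} [AddCommGroup Q] [Module k Q] [FiniteDimensional k Q]
  {T : HWTriple p k Q} {L M : Submodule k Q} {D E : Set (Submodule k Q)}

/-- The map `Ψ` with values in the whole dual space, that is, the pairing
`Ker Φ × Q → k, (x, y) ↦ Ψ(x)(y)`. -/
def pairing (T : HWTriple p k Q) : LinearMap.ker T.Φ →ₛₗ[frobenius k p] Module.Dual k Q :=
  (LinearMap.range T.Φ).dualAnnihilator.subtype.comp T.Ψ

theorem pairing_injective (T : HWTriple p k Q) : Function.Injective T.pairing :=
  Subtype.val_injective.comp T.bijective_Ψ.injective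

theorem pairing_apply_Φ (x : LinearMap.ker T.Φ) (y : Q) : T.pairing x (T.Φ y) = 0 :=
  (Submodule.mem_dualAnnihilator _).1 (T.Ψ x).2 _ (LinearMap.mem_range_self T.Φ y)

theorem exists_pairing_eq {φ : Module.Dual k Q} (hφ : ∀ y, φ (T.Φ y) = 0) :
    ∃ x, T.pairing x = φ := by
  obtain ⟨x, hx⟩ := T.bijective_Ψ.surjective
    ⟨φ, (Submodule.mem_dualAnnihilator φ).2 (by rintro _ ⟨y, rfl⟩; exact hφ y)⟩
  exact ⟨x, congrArg Subtype.val hx⟩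

/-- The orthogonal space of `L ∩ Ker Φ` with respect to `HWTriple.pairing`. -/
def orth (T : HWTriple p k Q) (L : Submodule k Q) : Submodule k Q :=
  ((L.submoduleOf (LinearMap.ker T.Φ)).map T.pairing).dualCoannihilator

theorem mem_orth {y : Q} :
    y ∈ T.orth L ↔ ∀ x : LinearMap.ker T.Φ, (x : Q) ∈ L → T.pairing x y = 0 := by
  simp only [orth, Submodule.mem_dualCoannihilator, Submodule.mem_map, forall_exists_index, and_imp,
    forall_apply_eq_imp_iff₂, Submodule.submoduleOf, Submodule.mem_comap, Submodule.subtype_apply]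

theorem mem_of_forall_mem_orth {x : LinearMap.ker T.Φ} (hx : ∀ y ∈ T.orth L, T.pairing x y = 0) :
    (x : Q) ∈ L := by
  have hmem := (Submodule.mem_dualAnnihilator (T.pairing x)).2 hx
  rw [orth, Subspace.dualCoannihilator_dualAnnihilator_eq] at hmem
  obtain ⟨x', hx', hxx'⟩ := hmem
  exact T.pairing_injective hxx' ▸ hx'

theorem orth_antitone (T : HWTriple p k Q) : Antitone T.orth := fun _ _ hLM _ hy =>
  mem_orth.2 fun x hx => mem_orth.1 hy x (hLM hx)

theorem orth_bot : T.orth ⊥ = ⊤ :=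
  eq_top_iff.2 fun y _ => mem_orth.2 fun x hx => by
    obtain rfl : x = 0 := Subtype.ext hx
    rw [map_zero, LinearMap.zero_apply]

theorem map_le_orth (L M : Submodule k Q) : L.map T.Φ ≤ T.orth M := by
  rintro _ ⟨y, -, rfl⟩
  exact mem_orth.2 fun x _ => pairing_apply_Φ x y

/-- The images and the orthogonal spaces of the members of a set of subspaces. -/
def refinement (T : HWTriple p k Q) (D : Set (Submodule k Q)) : Set (Submodule k Q) :=
  Submodule.map T.Φ '' D ∪ T.orth '' D

theorem map_mem_refinement (hL : L ∈ D) : L.map T.Φ ∈ T.refinement D :=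
  Or.inl (Set.mem_image_of_mem _ hL)

theorem orth_mem_refinement (hL : L ∈ D) : T.orth L ∈ T.refinement D :=
  Or.inr (Set.mem_image_of_mem _ hL)

theorem refinement_mono (T : HWTriple p k Q) : Monotone T.refinement := fun _ _ hDE =>
  Set.union_subset_union (Set.image_mono hDE) (Set.image_mono hDE)

theorem bot_mem_refinement (hD : ⊥ ∈ D) : ⊥ ∈ T.refinement D :=
  Submodule.map_bot T.Φ ▸ map_mem_refinement hD

theorem top_mem_refinement (hD : ⊥ ∈ D) : ⊤ ∈ T.refinement D :=
  orth_bot (T := T) ▸ orth_mem_refinement hD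

theorem isChain_refinement (T : HWTriple p k Q) (hD : IsChain (· ≤ ·) D) :
    IsChain (· ≤ ·) (T.refinement D) := by
  rintro _ (⟨L, hL, rfl⟩ | ⟨L, hL, rfl⟩) _ (⟨M, hM, rfl⟩ | ⟨M, hM, rfl⟩) -
  · exact (hD.total hL hM).imp (Submodule.map_mono ·) (Submodule.map_mono ·)
  · exact Or.inl (map_le_orth L M)
  · exact Or.inr (map_le_orth M L)
  · exact (hD.total hM hL).imp (orth_antitone T ·) (orth_antitone T ·)

theorem chainPred_refinement_map_le (hE : IsChain (· ≤ ·) E) (hL : L ∈ E) :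
    chainPred (T.refinement E) (L.map T.Φ) ≤ (chainPred E L).map T.Φ := by
  refine sSup_le ?_
  rintro _ ⟨⟨M, hM, rfl⟩ | ⟨M, -, rfl⟩, hlt⟩
  · exact (le_chainPred_or_le hE hM hL).elim (Submodule.map_mono ·)
      fun h => absurd (Submodule.map_mono h) hlt.not_ge
  · exact absurd (map_le_orth L M) hlt.not_ge

theorem chainPred_refinement_orth_le (hE : IsChain (· ≤ ·) E) (hL : L ∈ E) :
    chainPred (T.refinement E) (T.orth (chainPred E L)) ≤ T.orth L := by
  refine sSup_le ?_
  rintro _ ⟨⟨M, -, rfl⟩ | ⟨M, hM, rfl⟩, hlt⟩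
  · exact map_le_orth M L
  · exact (le_chainPred_or_le hE hM hL).elim (fun h => absurd (T.orth_antitone h) hlt.not_ge)
      (T.orth_antitone ·)

/-- The iterated refinements of the trivial chain `0 ⊆ Q`. They become stationary at a chain which
plays the role of the canonical filtration of `Q`. -/
def canonicalChain (T : HWTriple p k Q) (n : ℕ) : Set (Submodule k Q) :=
  T.refinement^[n] {⊥, ⊤}

theorem canonicalChain_succ (T : HWTriple p k Q) (n : ℕ) :
    T.canonicalChain (n + 1) = T.refinement (T.canonicalChain n) :=
  Function.iterate_succ_apply' _ _ _

theorem isChain_canonicalChain (T : HWTriple p k Q) (n : ℕ) :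
    IsChain (· ≤ ·) (T.canonicalChain n) := by
  induction n with
  | zero => exact IsChain.pair bot_le
  | succ n ih => exact T.canonicalChain_succ n ▸ T.isChain_refinement ih

theorem bot_mem_canonicalChain (T : HWTriple p k Q) (n : ℕ) : ⊥ ∈ T.canonicalChain n := by
  induction n with
  | zero => exact Set.mem_insert _ _
  | succ n ih => exact T.canonicalChain_succ n ▸ bot_mem_refinement ih

theorem canonicalChain_mono (T : HWTriple p k Q) : Monotone T.canonicalChain := by
  refine T.refinement_mono.monotone_iterate_of_le_map ?_
  rintro _ (rfl | rfl)
  · exact bot_mem_refinement (Set.mem_insert _ _)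
  · exact top_mem_refinement (Set.mem_insert _ _)

/-- A chain of subspaces which contains `0` and is its own refinement, so that `Φ` and `Ψ` permute
its graded pieces as far as they do not vanish on them. -/
structure IsStableChain (T : HWTriple p k Q) (D : Set (Submodule k Q)) : Prop where
  isChain : IsChain (· ≤ ·) D
  bot_mem : ⊥ ∈ D
  refinement_eq : T.refinement D = D

theorem exists_isStableChain_canonicalChain (T : HWTriple p k Q) :
    ∃ n, T.IsStableChain (T.canonicalChain n) := by
  obtain ⟨n, hn⟩ := exists_eq_succ_of_monotone_isChain T.canonicalChain_mono
    T.isChain_canonicalChain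
  exact ⟨n, T.isChain_canonicalChain n, T.bot_mem_canonicalChain n,
    (T.canonicalChain_succ n).symm.trans hn⟩

namespace IsStableChain

variable (hD : T.IsStableChain D)
include hD

theorem map_mem (hL : L ∈ D) : L.map T.Φ ∈ D :=
  hD.refinement_eq.subset (map_mem_refinement hL)

theorem orth_mem (hL : L ∈ D) : T.orth L ∈ D :=
  hD.refinement_eq.subset (orth_mem_refinement hL)

theorem top_mem : ⊤ ∈ D :=
  hD.refinement_eq.subset (top_mem_refinement hD.bot_mem)

theorem chainPred_mem (L : Submodule k Q) : chainPred D L ∈ D :=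
  _root_.chainPred_mem hD.isChain hD.bot_mem L

theorem chainPred_map_le (hL : L ∈ D) : chainPred D (L.map T.Φ) ≤ (chainPred D L).map T.Φ := by
  simpa only [hD.refinement_eq] using chainPred_refinement_map_le (T := T) hD.isChain hL

theorem chainPred_orth_le (hL : L ∈ D) : chainPred D (T.orth (chainPred D L)) ≤ T.orth L := by
  simpa only [hD.refinement_eq] using chainPred_refinement_orth_le (T := T) hD.isChain hL

end IsStableChain

/-- The multiplicative system for weights `a` on the graded pieces of a stable chain `D` which makes
an endomorphism with these weights intertwine, on graded pieces, `Φ` up to `c` and `Ψ` up to `d`.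
With `B'` the predecessor of `B`, the map `Φ` sends `B / B'` onto the graded piece below `Φ B`, and
`Ψ` pairs `(B ∩ Ker Φ) / (B' ∩ Ker Φ)` perfectly with the graded piece below `orth B'`; each
equation is imposed only if the target piece is nonzero. -/
structure IsCompatible (T : HWTriple p k Q) (c d : k) (D : Set (Submodule k Q))
    (a : Submodule k Q → k) : Prop where
  map_eq : ∀ B ∈ D, ¬ B.map T.Φ ≤ (chainPred D B).map T.Φ → a B ^ p = c * a (B.map T.Φ)
  orth_eq : ∀ B ∈ D, ¬ T.orth (chainPred D B) ≤ T.orth B →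
    a B ^ p * a (T.orth (chainPred D B)) = d

theorem injOn_map (hD : IsChain (· ≤ ·) D) :
    Set.InjOn (Submodule.map T.Φ) {L ∈ D | ¬ L.map T.Φ ≤ (chainPred D L).map T.Φ} := by
  rintro L ⟨hL, hjumpL⟩ M ⟨hM, hjumpM⟩ h
  exact le_antisymm
    ((le_chainPred_or_le hD hM hL).resolve_left fun hle =>
      hjumpL (h.trans_le (Submodule.map_mono hle)))
    ((le_chainPred_or_le hD hL hM).resolve_left fun hle =>
      hjumpM (h.symm.trans_le (Submodule.map_mono hle)))

theorem injOn_orth_chainPred (hD : IsChain (· ≤ ·) D) :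
    Set.InjOn (fun L => T.orth (chainPred D L)) {L ∈ D | ¬ T.orth (chainPred D L) ≤ T.orth L} := by
  rintro L ⟨hL, hjumpL⟩ M ⟨hM, hjumpM⟩ h
  exact le_antisymm
    ((le_chainPred_or_le hD hM hL).resolve_left fun hle =>
      hjumpM (h.symm.trans_le (T.orth_antitone hle)))
    ((le_chainPred_or_le hD hL hM).resolve_left fun hle =>
      hjumpL (h.trans_le (T.orth_antitone hle)))

theorem map_ne_orth_chainPred (hjump : ¬ T.orth (chainPred D M) ≤ T.orth M) :
    L.map T.Φ ≠ T.orth (chainPred D M) :=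
  fun h => hjump (h ▸ map_le_orth L M)

/-- `h'` is a lift of `h` if `Φ ∘ h' = c • h ∘ Φ` and `Ψ ∘ h' = d • (h^∨)⁻¹ ∘ Ψ` on `Ker Φ`, the
latter written without inverting `h`. A bijective lift of itself is an intertwiner. -/
structure IsLift (T : HWTriple p k Q) (c d : k) (h h' : Q →ₗ[k] Q) : Prop where
  apply_Φ : ∀ x, T.Φ (h' x) = c • h (T.Φ x)
  pairing_apply : ∀ x x' : LinearMap.ker T.Φ, (x' : Q) = h' x →
    ∀ y, T.pairing x' (h y) = d * T.pairing x y

variable {c d : k} {a : Submodule k Q → k} {W : Submodule k Q} {h h' h'' : Q →ₗ[k] Q}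

theorem IsLift.mem_ker (hh' : T.IsLift c d h h') {x : Q} (hx : x ∈ LinearMap.ker T.Φ) :
    h' x ∈ LinearMap.ker T.Φ := by
  rw [LinearMap.mem_ker, hh'.apply_Φ, LinearMap.mem_ker.1 hx, map_zero, smul_zero]

theorem exists_linearMap_Φ_eq (hW : IsCompl (LinearMap.ker T.Φ) W)
    (hrange : ∀ x ∈ LinearMap.range T.Φ, h x ∈ LinearMap.range T.Φ) (c : k) :
    ∃ u : Q →ₗ[k] W, ∀ x, T.Φ (u x) = c • h (T.Φ x) := by
  refine exists_linearMap_semilinear_apply_eq (f := T.Φ.comp W.subtype)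
    (g := c • h.comp T.Φ) ?_ fun x => ?_
  · refine (injective_iff_map_eq_zero _).2 fun w hw => ?_
    exact Subtype.ext ((Submodule.mem_bot k).1 (hW.disjoint.le_bot ⟨hw, w.2⟩))
  · obtain ⟨v, hv⟩ := (LinearMap.range T.Φ).smul_mem c (hrange _ (LinearMap.mem_range_self T.Φ x))
    obtain ⟨y, w, hy, hw, rfl⟩ := Submodule.codisjoint_iff_exists_add_eq.1 hW.codisjoint v
    refine ⟨⟨w, hw⟩, ?_⟩
    rwa [map_add, LinearMap.mem_ker.1 hy, zero_add] at hv

theorem exists_linearMap_pairing_eq (hinj : Function.Injective h)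
    (hrange : ∀ x ∈ LinearMap.range T.Φ, h x ∈ LinearMap.range T.Φ) (d : k) :
    ∃ u : LinearMap.ker T.Φ →ₗ[k] LinearMap.ker T.Φ,
      ∀ x y, T.pairing (u x) (h y) = d * T.pairing x y := by
  let e : Q ≃ₗ[k] Q := LinearEquiv.ofInjectiveEndo h hinj
  obtain ⟨u, hu⟩ := exists_linearMap_semilinear_apply_eq (f := T.pairing)
    (g := d • (e.dualMap.symm.toLinearMap.comp T.pairing)) T.pairing_injective fun x =>
      exists_pairing_eq fun y => by
        obtain ⟨_, ⟨z, rfl⟩, hz⟩ := exists_mem_apply_eq_of_injective hinj hrange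
          (LinearMap.mem_range_self T.Φ y)
        have hz' : e.symm (T.Φ y) = T.Φ z := e.symm_apply_eq.2 hz.symm
        change d * T.pairing x (e.symm (T.Φ y)) = 0
        rw [hz', pairing_apply_Φ, mul_zero]
  refine ⟨u, fun x y => ?_⟩
  rw [hu]
  change d * T.pairing x (e.symm (e y)) = d * T.pairing x y
  rw [e.symm_apply_apply]

theorem exists_isLift (hinj : Function.Injective h)
    (hrange : ∀ x ∈ LinearMap.range T.Φ, h x ∈ LinearMap.range T.Φ)
    (hW : IsCompl (LinearMap.ker T.Φ) W) (c d : k) :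
    ∃ h', T.IsLift c d h h' ∧ ∀ x ∈ W, h' x ∈ W := by
  obtain ⟨u, hu⟩ := exists_linearMap_pairing_eq hinj hrange d
  obtain ⟨v, hv⟩ := exists_linearMap_Φ_eq hW hrange c
  let h' := LinearMap.ofIsCompl hW ((LinearMap.ker T.Φ).subtype ∘ₗ u) (W.subtype ∘ₗ v ∘ₗ W.subtype)
  have hker : ∀ y : LinearMap.ker T.Φ, h' y = u y := LinearMap.ofIsCompl_apply_left hW
  have hcompl : ∀ w : W, h' w = v w := LinearMap.ofIsCompl_apply_right hW
  refine ⟨h', ⟨fun x => ?_, fun x x' hx' y => ?_⟩, fun w hw => ?_⟩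
  · obtain ⟨y, w, hy, hw, rfl⟩ := Submodule.codisjoint_iff_exists_add_eq.1 hW.codisjoint x
    calc T.Φ (h' (y + w)) = T.Φ (u ⟨y, hy⟩) + T.Φ (v w) := by
          rw [map_add, map_add, ← hker ⟨y, hy⟩, ← hcompl ⟨w, hw⟩]
      _ = c • h (T.Φ (y + w)) := by
          rw [LinearMap.mem_ker.1 (u _).2, hv, map_add, LinearMap.mem_ker.1 hy, zero_add, zero_add]
  · obtain rfl : x' = u x := Subtype.ext (hx'.trans (hker x))
    exact hu x y
  · exact hcompl ⟨w, hw⟩ ▸ (v w).2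

theorem mem_of_Φ_mem_map (hW : IsAdaptedCompl D (LinearMap.ker T.Φ) W) (hL : L ∈ D) {x : Q}
    (hxW : x ∈ W) (hx : T.Φ x ∈ L.map T.Φ) : x ∈ L := by
  obtain ⟨y, hy, hyx⟩ := hx
  obtain ⟨u, hu, w, hw, rfl⟩ := Submodule.mem_sup.1 (hW.le_sup L hL hy)
  rw [map_add, LinearMap.mem_ker.1 hu.2, zero_add] at hyx
  have hker : w - x ∈ LinearMap.ker T.Φ := by rw [LinearMap.mem_ker, map_sub, hyx, sub_self]
  have hzero := hW.isCompl.disjoint.le_bot ⟨hker, W.sub_mem hw.2 hxW⟩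
  rw [← sub_eq_zero.1 ((Submodule.mem_bot k).1 hzero)]
  exact hw.1

theorem apply_mem_of_Φ_of_pairing (hW : IsAdaptedCompl D (LinearMap.ker T.Φ) W) (hL : L ∈ D)
    (hM : M ∈ D) (hker : ∀ x ∈ LinearMap.ker T.Φ, h x ∈ LinearMap.ker T.Φ) (hWW : ∀ x ∈ W, h x ∈ W)
    (hΦ : ∀ x ∈ M, T.Φ (h x) ∈ L.map T.Φ)
    (hpair : ∀ x x' : LinearMap.ker T.Φ, (x : Q) ∈ M → (x' : Q) = h x →
      ∀ y ∈ T.orth L, T.pairing x' y = 0) :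
    ∀ x ∈ M, h x ∈ L := by
  intro x hx
  obtain ⟨u, hu, w, hw, rfl⟩ := Submodule.mem_sup.1 (hW.le_sup M hM hx)
  rw [map_add]
  exact L.add_mem
    (mem_of_forall_mem_orth (hpair ⟨u, hu.2⟩ ⟨h u, hker u hu.2⟩ hu.1 rfl))
    (mem_of_Φ_mem_map hW hL (hWW w hw.2) (hΦ w hw.1))

theorem IsLift.Φ_sub_smul_mem_map (hD : T.IsStableChain D) (ha : T.IsCompatible c d D a)
    (hh : HasWeights D a h) (hl : T.IsLift c d h h') (hL : L ∈ D) {x : Q} (hx : x ∈ L) :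
    T.Φ (h' x - a L • x) ∈ (chainPred D L).map T.Φ := by
  have hΦx : T.Φ x ∈ L.map T.Φ := Submodule.mem_map_of_mem hx
  rw [map_sub, hl.apply_Φ, map_smulₛₗ, frobenius_def]
  by_cases hjump : L.map T.Φ ≤ (chainPred D L).map T.Φ
  · have hmap : (chainPred D L).map T.Φ ∈ D := hD.map_mem (hD.chainPred_mem L)
    exact Submodule.sub_mem _ (Submodule.smul_mem _ _ (hh.apply_mem hmap (hjump hΦx)))
      (Submodule.smul_mem _ _ (hjump hΦx))
  · rw [ha.map_eq L hL hjump, mul_smul, ← smul_sub]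
    exact Submodule.smul_mem _ _ (hD.chainPred_map_le hL (hh _ (hD.map_mem hL) _ hΦx))

theorem IsLift.pairing_sub_smul_eq_zero (hD : T.IsStableChain D) (ha : T.IsCompatible c d D a)
    (hinj : Function.Injective h) (hh : HasWeights D a h) (hl : T.IsLift c d h h') (hL : L ∈ D)
    {x x' : LinearMap.ker T.Φ} (hx : (x : Q) ∈ L) (hx' : (x' : Q) = h' x - a L • (x : Q)) {y : Q}
    (hy : y ∈ T.orth (chainPred D L)) : T.pairing x' y = 0 := by
  have horth : T.orth (chainPred D L) ∈ D := hD.orth_mem (hD.chainPred_mem L)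
  obtain ⟨z, hz, rfl⟩ := exists_mem_apply_eq_of_injective hinj (fun _ => hh.apply_mem horth) hy
  let x₁ : LinearMap.ker T.Φ := ⟨h' x, hl.mem_ker x.2⟩
  obtain rfl : x' = x₁ - a L • x := Subtype.ext hx'
  have hdiff : T.pairing (x₁ - a L • x) (h z) =
      d * T.pairing x z - a L ^ p * T.pairing x (h z) := by
    rw [map_sub, map_smulₛₗ, LinearMap.sub_apply, LinearMap.smul_apply, smul_eq_mul,
      frobenius_def, hl.pairing_apply x x₁ rfl]
  rw [hdiff]
  by_cases hjump : T.orth (chainPred D L) ≤ T.orth L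
  · rw [mem_orth.1 (hjump hz) x hx, mem_orth.1 (hjump (hh.apply_mem horth hz)) x hx,
      mul_zero, mul_zero, sub_zero]
  · have hgr := mem_orth.1 (hD.chainPred_orth_le hL (hh _ horth _ hz)) x hx
    rw [map_sub, map_smul, smul_eq_mul, sub_eq_zero] at hgr
    rw [hgr, ← mul_assoc, ha.orth_eq L hL hjump, sub_self]

theorem IsLift.hasWeights (hD : T.IsStableChain D) (hW : IsAdaptedCompl D (LinearMap.ker T.Φ) W)
    (ha : T.IsCompatible c d D a) (hinj : Function.Injective h) (hh : HasWeights D a h)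
    (hl : T.IsLift c d h h') (hWW : ∀ x ∈ W, h' x ∈ W) : HasWeights D a h' := fun L hL =>
  apply_mem_of_Φ_of_pairing (h := h' - a L • (LinearMap.id : Q →ₗ[k] Q)) hW (hD.chainPred_mem L) hL
    (fun _ hx => Submodule.sub_mem _ (hl.mem_ker hx) (Submodule.smul_mem _ _ hx))
    (fun x hx => W.sub_mem (hWW x hx) (W.smul_mem _ hx))
    (fun _ hx => hl.Φ_sub_smul_mem_map hD ha hh hL hx)
    (fun _ _ hx hx' _ hy => hl.pairing_sub_smul_eq_zero hD ha hinj hh hL hx hx' hy)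

theorem IsLift.hasWeights_sub (hD : T.IsStableChain D)
    (hW : IsAdaptedCompl D (LinearMap.ker T.Φ) W) (hE : IsChain (· ≤ ·) E) (hbot : ⊥ ∈ E)
    (hED : E ⊆ D) (hinj : Function.Injective h') (hh' : HasWeights D a h')
    (hl : T.IsLift c d h h') (hl' : T.IsLift c d h' h'') (hWW' : ∀ x ∈ W, h' x ∈ W)
    (hWW'' : ∀ x ∈ W, h'' x ∈ W) (hsub : HasWeights (T.refinement E) 0 (h' - h)) :
    HasWeights E 0 (h'' - h') := by
  intro B hB x hx
  set A := chainPred E B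
  have hA : A ∈ E := chainPred_mem hE hbot B
  rw [Pi.zero_apply, zero_smul, sub_zero]
  revert x
  refine apply_mem_of_Φ_of_pairing hW (hED hA) (hED hB)
    (fun x hx => Submodule.sub_mem _ (hl'.mem_ker hx) (hl.mem_ker hx))
    (fun x hx => W.sub_mem (hWW'' x hx) (hWW' x hx)) (fun x hx => ?_) ?_
  · have hmem := hsub _ (map_mem_refinement hB) _ (Submodule.mem_map_of_mem hx)
    rw [Pi.zero_apply, zero_smul, sub_zero] at hmem
    rw [LinearMap.sub_apply, map_sub, hl'.apply_Φ, hl.apply_Φ, ← smul_sub]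
    exact Submodule.smul_mem _ _ (chainPred_refinement_map_le hE hB hmem)
  · intro x x' hx hx' y hy
    obtain ⟨z, hz, rfl⟩ := exists_mem_apply_eq_of_injective hinj
      (fun _ => hh'.apply_mem (hD.orth_mem (hED hA))) hy
    let x₁ : LinearMap.ker T.Φ := ⟨h' x, hl.mem_ker x.2⟩
    let x₂ : LinearMap.ker T.Φ := ⟨h'' x, hl'.mem_ker x.2⟩
    obtain rfl : x' = x₂ - x₁ := Subtype.ext hx'
    have hmem := hsub _ (orth_mem_refinement hA) z hz
    rw [Pi.zero_apply, zero_smul, sub_zero] at hmem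
    calc T.pairing (x₂ - x₁) (h' z)
        = T.pairing x₁ (h z) - T.pairing x₁ (h' z) := by
          rw [map_sub, LinearMap.sub_apply, hl'.pairing_apply x x₂ rfl, hl.pairing_apply x x₁ rfl]
      _ = -T.pairing x₁ ((h' - h) z) := by rw [LinearMap.sub_apply, map_sub, neg_sub]
      _ = 0 := by
          rw [mem_orth.1 (chainPred_refinement_orth_le hE hB hmem) x₁
            (hh'.apply_mem (hED hB) hx), neg_zero]

theorem IsLift.intertwines_ofInjectiveEndo (hinj : Function.Injective h) (hh : T.IsLift c d h h) :
    T.Intertwines T c d (LinearEquiv.ofInjectiveEndo h hinj) := by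
  refine ⟨hh.apply_Φ, fun x => LinearMap.ext fun y => ?_⟩
  obtain ⟨z, rfl⟩ := (LinearEquiv.ofInjectiveEndo h hinj).surjective y
  change T.pairing _ (h z) = d * T.pairing x ((LinearEquiv.ofInjectiveEndo h hinj).symm _)
  rw [LinearEquiv.symm_apply_apply]
  exact hh.pairing_apply x _ rfl z

theorem exists_isLift_hasWeights (hD : T.IsStableChain D)
    (hW : IsAdaptedCompl D (LinearMap.ker T.Φ) W) (ha : T.IsCompatible c d D a) (ha0 : ∀ L, a L ≠ 0)
    (hh : HasWeights D a h) :
    ∃ h', T.IsLift c d h h' ∧ HasWeights D a h' ∧ ∀ x ∈ W, h' x ∈ W := by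
  have hinj := hh.injective hD.isChain hD.bot_mem hD.top_mem ha0
  have hrange : LinearMap.range T.Φ ∈ D := LinearMap.range_eq_map T.Φ ▸ hD.map_mem hD.top_mem
  obtain ⟨h', hl, hWW⟩ := exists_isLift hinj (fun _ => hh.apply_mem hrange) hW.isCompl c d
  exact ⟨h', hl, hl.hasWeights hD hW ha hinj hh hWW, hWW⟩

theorem exists_isLift_hasWeights_sub {N n : ℕ} (hn : n ≤ N)
    (hD : T.IsStableChain (T.canonicalChain N)) (ha : T.IsCompatible c d (T.canonicalChain N) a)
    (ha0 : ∀ L, a L ≠ 0) (hW : IsAdaptedCompl (T.canonicalChain N) (LinearMap.ker T.Φ) W) :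
    ∃ h h', T.IsLift c d h h' ∧ HasWeights (T.canonicalChain N) a h' ∧ (∀ x ∈ W, h' x ∈ W) ∧
      HasWeights (T.canonicalChain n) 0 (h' - h) := by
  induction hn using Nat.decreasingInduction with
  | self =>
    obtain ⟨h, hh⟩ := exists_hasWeights hD.isChain a
    obtain ⟨h', hl, hh', hWW'⟩ := exists_isLift_hasWeights hD hW ha ha0 hh
    exact ⟨h, h', hl, hh', hWW', sub_self a ▸ hh'.sub hh⟩
  | of_succ n hn ih =>
    obtain ⟨h, h', hl, hh', hWW', hsub⟩ := ih
    obtain ⟨h'', hl', hh'', hWW''⟩ := exists_isLift_hasWeights hD hW ha ha0 hh'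
    have hinj := hh'.injective hD.isChain hD.bot_mem hD.top_mem ha0
    rw [canonicalChain_succ] at hsub
    exact ⟨h', h'', hl', hh'', hWW'', hl.hasWeights_sub hD hW (T.isChain_canonicalChain n)
      (T.bot_mem_canonicalChain n) (T.canonicalChain_mono hn.le) hinj hh' hl' hWW' hWW'' hsub⟩

end Refinement

section AlgClosed

variable [IsAlgClosed k] {Q : Type*} [AddCommGroup Q] [Module k Q] [FiniteDimensional k Q]
  {T : HWTriple p k Q} {D : Set (Submodule k Q)} {c d : k}

theorem exists_isCompatible (hD : T.IsStableChain D) (hc : c ≠ 0) (hd : d ≠ 0) :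
    ∃ a : Submodule k Q → k, (∀ L, a L ≠ 0) ∧ T.IsCompatible c d D a := by
  lift c to kˣ using hc.isUnit
  lift d to kˣ using hd.isUnit
  have : Finite D := finite_of_isChain hD.isChain
  let X : Set (Submodule k Q) := {L ∈ D | ¬ L.map T.Φ ≤ (chainPred D L).map T.Φ}
  let Y : Set (Submodule k Q) := {L ∈ D | ¬ T.orth (chainPred D L) ≤ T.orth L}
  let τ : X ⊕ Y → D := Sum.elim (fun L => ⟨L.1.map T.Φ, hD.map_mem L.2.1⟩)
    (fun L => ⟨T.orth (chainPred D L), hD.orth_mem (hD.chainPred_mem L)⟩)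
  have hτ : Function.Injective τ := Function.Injective.sumElim
    (fun L M h => Subtype.ext (injOn_map hD.isChain L.2 M.2 (congrArg Subtype.val h)))
    (fun L M h => Subtype.ext (injOn_orth_chainPred hD.isChain L.2 M.2 (congrArg Subtype.val h)))
    fun _ M h => map_ne_orth_chainPred M.2.2 (congrArg Subtype.val h)
  obtain ⟨a, ha⟩ := exists_apply_eq_mul_zpow (Fact.out : p.Prime).ne_one hτ
    (Sum.elim (fun L => ⟨L, L.2.1⟩) (fun L => ⟨L, L.2.1⟩)) (Sum.elim (fun _ => 1) (fun _ => -1))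
    (Sum.elim (fun _ => c⁻¹) (fun _ => d))
  have hext : ∀ L (hL : L ∈ D), Function.extend Subtype.val a 1 L = a ⟨L, hL⟩ := fun L hL =>
    Subtype.val_injective.extend_apply a 1 ⟨L, hL⟩
  refine ⟨fun L => (Function.extend Subtype.val a 1 L : kˣ), fun L => Units.ne_zero _,
    ⟨fun B hB hjump => ?_, fun B hB hjump => ?_⟩⟩
  · have hB' : a ⟨_, hD.map_mem hB⟩ = c⁻¹ * a ⟨B, hB⟩ ^ ((p : ℤ) * 1) :=
      ha (Sum.inl ⟨B, hB, hjump⟩)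
    rw [mul_one, zpow_natCast, eq_inv_mul_iff_mul_eq] at hB'
    rw [hext B hB, hext _ (hD.map_mem hB)]
    exact_mod_cast hB'.symm
  · have hB' : a ⟨_, hD.orth_mem (hD.chainPred_mem B)⟩ = d * a ⟨B, hB⟩ ^ ((p : ℤ) * -1) :=
      ha (Sum.inr ⟨B, hB, hjump⟩)
    rw [mul_neg_one, zpow_neg, zpow_natCast, eq_mul_inv_iff_mul_eq, mul_comm] at hB'
    rw [hext B hB, hext _ (hD.orth_mem (hD.chainPred_mem B))]
    exact_mod_cast hB'

theorem exists_intertwines_self (T : HWTriple p k Q) (hc : c ≠ 0) (hd : d ≠ 0) :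
    ∃ g : Q ≃ₗ[k] Q, T.Intertwines T c d g := by
  obtain ⟨N, hD⟩ := T.exists_isStableChain_canonicalChain
  obtain ⟨a, ha0, ha⟩ := exists_isCompatible hD hc hd
  obtain ⟨W, hW⟩ := exists_isAdaptedCompl hD.isChain hD.bot_mem hD.top_mem (LinearMap.ker T.Φ)
  obtain ⟨h, h', hl, hh', -, hsub⟩ := exists_isLift_hasWeights_sub N.zero_le hD ha ha0 hW
  obtain rfl : h' = h := sub_eq_zero.1 (eq_zero_of_hasWeights_bot_top hsub)
  exact ⟨_, hl.intertwines_ofInjectiveEndo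
    (hh'.injective hD.isChain hD.bot_mem hD.top_mem ha0)⟩

end AlgClosed

theorem Intertwines.trans [PerfectRing k p] {Q₁ Q₂ Q₃ : Type*}
    [AddCommGroup Q₁] [Module k Q₁] [FiniteDimensional k Q₁]
    [AddCommGroup Q₂] [Module k Q₂] [FiniteDimensional k Q₂]
    [AddCommGroup Q₃] [Module k Q₃] [FiniteDimensional k Q₃]
    {T₁ : HWTriple p k Q₁} {T₂ : HWTriple p k Q₂} {T₃ : HWTriple p k Q₃} {c d c' d' : k}
    {f : Q₁ ≃ₗ[k] Q₂} {g : Q₂ ≃ₗ[k] Q₃} (hf : T₁.Intertwines T₂ c d f)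
    (hg : T₂.Intertwines T₃ c' d' g) : T₁.Intertwines T₃ (c * c') (d * d') (f.trans g) := by
  obtain ⟨hΦf, hΨf⟩ := hf
  obtain ⟨hΦg, hΨg⟩ := hg
  refine ⟨fun x => ?_, fun x => ?_⟩
  · rw [LinearEquiv.trans_apply, LinearEquiv.trans_apply, hΦg, hΦf, map_smul, smul_smul, mul_comm]
  · refine (hΨg ⟨f x, map_mem_ker hΦf x⟩).trans ?_
    rw [hΨf, map_smul, smul_smul, mul_comm]
    rfl

end HWTriple

theorem proposition2p8 (p : ℕ) [Fact p.Prime] (k : Type*) [Field k] [CharP k p] [IsAlgClosed k]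
    (Q₁ Q₂ : Type*) [AddCommGroup Q₁] [Module k Q₁] [FiniteDimensional k Q₁]
    [AddCommGroup Q₂] [Module k Q₂] [FiniteDimensional k Q₂]
    (T₁ : HWTriple p k Q₁) (T₂ : HWTriple p k Q₂) (h : T₁.Equivalent T₂) :
    T₁.Isomorphic T₂ := by
  obtain ⟨f, c, d, hc, hd, hf⟩ := h
  obtain ⟨g, hg⟩ := T₁.exists_intertwines_self (inv_ne_zero hc) (inv_ne_zero hd)
  refine ⟨g.trans f, ?_⟩
  simpa only [inv_mul_cancel₀ hc, inv_mul_cancel₀ hd] using hg.trans hf
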